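/- Let $\mathcal{H}$ be a separable complex Hilbert space, let $\mathcal{S}(\mathcal{H})$ be the set of density operators on $\mathcal{H}$ (positive semi-definite bounded operators with unit trace), let $\mathcal{X}$ be a finite set, let $W:\mathcal{X}\to\mathcal{S}(\mathcal{H})$, $x\mapsto W_x$, be a classical-quantum channel, and let $P$ be a probability distribution on $\mathcal{X}$. For $t\ge 1$ put $$F(t)=\operatorname{Tr}\Big[\Big(\sum_{x\in\mathcal{X}}P(x)\,W_x^{1/t}\Big)^{t}\Big].$$ Then $0<F(t)<\infty$ for every $t\ge 1$, and the auxiliary function $$E_0(s,P)=-\log\operatorname{Tr}\Big[\Big(\sum_{x\in\mathcal{X}}P(x)\,W_x^{1/(1+s)}\Big)^{1+s}\Big]=-\log F(1+s)$$ is concave in $s$ on $[0,\infty)$. Equivalently, $t\mapsto \log F(t)=\log\operatorname{Tr}\big[(\mathbb{E}\,W_X^{1/t})^{t}\big]$, with $X$ distributed according to $P$, is convex on $[1,\infty)$. -/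

import Mathlib

open scoped ENNReal InnerProductSpace

noncomputable section

namespace CQ

variable {H : Type*} [NormedAddCommGroup H] [InnerProductSpace ℂ H] [CompleteSpace H]

/-- The sum of the diagonal entries of a bounded operator in a Hilbert basis, as an extended
nonnegative real (meant for positive operators, whose diagonal entries are nonnegative reals). -/
def traceIn {ι : Type*} (b : HilbertBasis ι ℂ H) (T : H →L[ℂ] H) : ℝ≥0∞ :=
  ∑' i, ENNReal.ofReal (RCLike.re ⟪b i, T (b i)⟫_ℂ)

/-- Parseval's identity with extended nonnegative values. -/
theorem tsum_enorm_inner_sq {ι : Type*} (b : HilbertBasis ι ℂ H) (v : H) :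
    ∑' i, ENNReal.ofReal (‖⟪b i, v⟫_ℂ‖ ^ 2) = ENNReal.ofReal (‖v‖ ^ 2) := by
  have h := b.hasSum_inner_mul_inner v v
  have h2 : HasSum (fun i => ‖⟪b i, v⟫_ℂ‖ ^ 2) (‖v‖ ^ 2) := by
    have h3 := Complex.hasSum_re h
    have e1 : (⟪v, v⟫_ℂ).re = ‖v‖ ^ 2 := by
      simpa using (inner_self_eq_norm_sq (𝕜 := ℂ) v)
    rw [e1] at h3
    convert h3 using 2 with i
    rw [← inner_conj_symm v (b i), ← Complex.normSq_eq_conj_mul_self, Complex.ofReal_re,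
      Complex.normSq_eq_norm_sq]
  rw [← ENNReal.ofReal_tsum_of_nonneg (fun i => by positivity) h2.summable, h2.tsum_eq]

/-- The trace of a positive operator does not depend on the Hilbert basis. -/
theorem traceIn_eq {ι κ : Type*} (b : HilbertBasis ι ℂ H) (c : HilbertBasis κ ℂ H)
    {T : H →L[ℂ] H} (hT : 0 ≤ T) : traceIn b T = traceIn c T := by
  obtain ⟨S, hS, rfl⟩ : ∃ S : H →L[ℂ] H, IsSelfAdjoint S ∧ T = S * S :=
    ⟨CFC.sqrt T, (CFC.sqrt_nonneg T).isSelfAdjoint, (CFC.sqrt_mul_sqrt_self T).symm⟩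
  have sym : ∀ x y : H, ⟪x, S y⟫_ℂ = ⟪S x, y⟫_ℂ := fun x y =>
    ((ContinuousLinearMap.isSelfAdjoint_iff_isSymmetric.mp hS) x y).symm
  have key : ∀ x : H, RCLike.re ⟪x, (S * S) x⟫_ℂ = ‖S x‖ ^ 2 := by
    intro x
    rw [mul_apply_eq_comp, sym]
    exact inner_self_eq_norm_sq (𝕜 := ℂ) (S x)
  simp only [traceIn, key]
  calc ∑' i, ENNReal.ofReal (‖S (b i)‖ ^ 2)
      = ∑' i, ∑' j, ENNReal.ofReal (‖⟪c j, S (b i)⟫_ℂ‖ ^ 2) := by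
        simp only [tsum_enorm_inner_sq]
    _ = ∑' j, ∑' i, ENNReal.ofReal (‖⟪c j, S (b i)⟫_ℂ‖ ^ 2) := ENNReal.tsum_comm
    _ = ∑' j, ∑' i, ENNReal.ofReal (‖⟪b i, S (c j)⟫_ℂ‖ ^ 2) := by
        simp only [sym, norm_inner_symm]
    _ = ∑' j, ENNReal.ofReal (‖S (c j)‖ ^ 2) := by
        simp only [tsum_enorm_inner_sq]

/-- The trace `Tr T ∈ [0, ∞]` of a positive bounded operator `T`, computed in some Hilbert basis;
a positive operator is of trace class exactly when this is finite. -/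
def trace (T : H →L[ℂ] H) : ℝ≥0∞ :=
  traceIn (exists_hilbertBasis ℂ H).choose_spec.choose T

/-- The trace of a positive operator may be computed in any Hilbert basis. -/
theorem trace_eq {ι : Type*} (b : HilbertBasis ι ℂ H) {T : H →L[ℂ] H} (hT : 0 ≤ T) :
    trace T = ∑' i, ENNReal.ofReal (RCLike.re ⟪b i, T (b i)⟫_ℂ) :=
  traceIn_eq _ b hT

variable (H) in
/-- Density operators: positive operators of unit trace. -/
def densityOperators : Set (H →L[ℂ] H) := {ρ | 0 ≤ ρ ∧ trace ρ = 1}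

/-- A classical-quantum channel: a map from the input alphabet to the density operators. -/
abbrev Channel (X : Type*) (H : Type*) [NormedAddCommGroup H] [InnerProductSpace ℂ H]
    [CompleteSpace H] := X → densityOperators H

variable {X : Type*} [Fintype X]

/-- The expectation `𝔼 W_X ^ a = ∑ x, P x • W_x ^ a`, for `X` distributed according to `P`;
the power is the one of the continuous functional calculus. -/
def meanPow (W : Channel X H) (P : stdSimplex ℝ X) (a : ℝ) : H →L[ℂ] H :=
  ∑ x, (P : X → ℝ) x • ((W x : H →L[ℂ] H) ^ a)

/-- The extended nonnegative real `Tr [(𝔼 W_X ^ (1 / t)) ^ t]`. -/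
def tracePow (W : Channel X H) (P : stdSimplex ℝ X) (t : ℝ) : ℝ≥0∞ :=
  trace (meanPow W P (1 / t) ^ t)

/-- The auxiliary function
`E₀(s, P) = - log Tr [(∑ x, P x • W_x ^ (1 / (1 + s))) ^ (1 + s)]`. -/
def E₀ (W : Channel X H) (s : ℝ) (P : stdSimplex ℝ X) : ℝ :=
  -Real.log (trace ((∑ x, (P : X → ℝ) x • ((W x : H →L[ℂ] H) ^ (1 / (1 + s)))) ^ (1 + s))).toReal

end CQ

end

namespace CQ

open Filter Topology

/-! Write `A_t = 𝔼 W_X ^ (1/t)` and let `b i` be an eigenbasis of `A_t` with eigenvalues `a i`. Then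
`F(t) = ∑ a_i ^ t = ∑_{i,x} a_i ^ (t-1) P(x) ⟨b_i, W_x ^ (1/t) b_i⟩`. If `1/t = p/t₀ + q/t₁` with `p
+ q = 1`, the diagonal elements of powers of `W_x` are log-convex in the exponent, and Hölder over
the pairs `(i, x)` bounds `F(t)` by a product of two sums in which `A_t₀` and `A_t₁` appear in the
same basis `b`. By Hölder and Jensen, the sum for `r = t₀, t₁` is at most `F(t) ^ (1 - 1/r) * F(r) ^
(1/r)` (`tsum_rpow_mul_diag_meanPow_le`). Since `0 < F(t) < ∞`, the powers of `F(t)` cancel, leaving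
`log F(t) / t ≤ (p/t₀) log F(t₀) + (q/t₁) log F(t₁)`. For `t = α t₀ + β t₁` the weights `p = α
t₀/t`, `q = β t₁/t` turn this into convexity. -/

/-- Hölder's inequality for sums of extended nonnegative reals, with exponents of sum one. -/
theorem tsum_rpow_mul_rpow_le {ι : Type*} (f g : ι → ℝ≥0∞) {p q : ℝ} (hp : 0 ≤ p) (hq : 0 ≤ q)
    (hpq : p + q = 1) :
    ∑' i, f i ^ p * g i ^ q ≤ (∑' i, f i) ^ p * (∑' i, g i) ^ q := by
  let _ : MeasurableSpace ι := ⊤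
  simpa [MeasureTheory.lintegral_count] using
    ENNReal.lintegral_mul_norm_pow_le (μ := MeasureTheory.Measure.count)
      (f := f) (g := g) (by fun_prop) (by fun_prop) hp hq hpq

variable {H : Type*} [NormedAddCommGroup H] [InnerProductSpace ℂ H] [CompleteSpace H]

/-! ### Functional calculus, compactness and eigenbases. -/

/-- An eigenvector of a self-adjoint operator is an eigenvector of its functional calculus. -/
theorem cfc_apply_of_apply_eq_smul {T : H →L[ℂ] H} (hT : IsSelfAdjoint T) {f : ℝ → ℝ}
    (hf : ContinuousOn f (spectrum ℝ T)) {c : ℝ} {v : H} (hv : T v = (c : ℂ) • v) :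
    cfc f T v = (f c : ℂ) • v := by
  rcases eq_or_ne v 0 with rfl | hv0
  · simp
  have hc : c ∈ spectrum ℝ T := by
    intro h
    obtain ⟨u, hu⟩ := h
    have h1 : (u : H →L[ℂ] H) v = 0 := by
      rw [hu, sub_apply, hv, Algebra.algebraMap_eq_smul_one]
      simp
    have h2 : ((↑u⁻¹ : H →L[ℂ] H) * (u : H →L[ℂ] H)) v = v := by simp
    rw [mul_apply_eq_comp, h1, map_zero] at h2
    exact hv0 h2.symm
  have key : ∀ g : C(spectrum ℝ T, ℝ),
      cfcHom (R := ℝ) (p := IsSelfAdjoint) hT g v = (g ⟨c, hc⟩ : ℂ) • v := by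
    intro g
    induction g using ContinuousMap.induction_on_of_compact with
    | const r =>
      have : ContinuousMap.const (spectrum ℝ T) r = algebraMap ℝ C(spectrum ℝ T, ℝ) r := rfl
      rw [this, AlgHomClass.commutes, Algebra.algebraMap_eq_smul_one]
      simp
    | id =>
      rw [cfcHom_id]
      simpa using hv
    | star_id =>
      rw [map_star, cfcHom_id, hT.star_eq]
      simpa using hv
    | add f g hf hg => rw [map_add]; simp [hf, hg, add_smul]
    | mul f g hf hg =>
      rw [map_mul, mul_apply_eq_comp, hg, map_smul, hf, smul_smul]
      simp [mul_comm]
    | frequently f hf =>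
      have hcl : IsClosed {g : C(spectrum ℝ T, ℝ) |
          cfcHom (R := ℝ) (p := IsSelfAdjoint) hT g v = (g ⟨c, hc⟩ : ℂ) • v} := by
        refine isClosed_eq ?_ ?_
        · exact (ContinuousLinearMap.apply ℂ H v).continuous.comp (cfcHom_continuous hT)
        · fun_prop
      exact hcl.closure_subset_iff.mpr subset_rfl (mem_closure_iff_frequently.mpr hf)
  rw [cfc_apply f T hT hf, key]
  rfl

theorem rpow_apply_of_apply_eq_smul {T : H →L[ℂ] H} (hT : 0 ≤ T) {s c : ℝ} (hs : 0 ≤ s) {v : H}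
    (hv : T v = (c : ℂ) • v) : (T ^ s) v = ((c ^ s : ℝ) : ℂ) • v := by
  rw [CFC.rpow_eq_cfc_real hT]
  exact cfc_apply_of_apply_eq_smul hT.isSelfAdjoint
    (Real.continuous_rpow_const hs).continuousOn hv

/-- Positive powers of a compact positive operator are compact. -/
theorem isCompactOperator_rpow {T : H →L[ℂ] H} (hT : 0 ≤ T) (hc : IsCompactOperator T) {s : ℝ}
    (hs : 0 < s) : IsCompactOperator (T ^ s) := by
  have hsa : IsSelfAdjoint T := hT.isSelfAdjoint
  -- `x * g ε x` is a cutoff of `x ^ s`: exact for `x ≥ ε`, while on `[0, ε]` both lie in `[0, ε ^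
  -- s]`. The cutoff keeps `g ε` continuous at `0` when `s < 1`.
  let g : ℝ → ℝ → ℝ := fun ε x => max x ε ^ (s - 1)
  have hg : ∀ ε, 0 < ε → Continuous (g ε) := fun ε hε =>
    (continuous_id.max continuous_const).rpow_const
      fun x => Or.inl (lt_of_lt_of_le hε (le_max_right _ _)).ne'
  have hbound : ∀ ε, 0 < ε → ‖T ^ s - T * cfc (g ε) T‖ ≤ ε ^ s := by
    intro ε hε
    have e : T ^ s - T * cfc (g ε) T = cfc (fun x : ℝ => x ^ s - x * g ε x) T := by
      have h1 : Continuous fun x : ℝ => x ^ s := Real.continuous_rpow_const hs.le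
      have h2 := hg ε hε
      rw [CFC.rpow_eq_cfc_real hT, cfc_sub (fun x : ℝ => x ^ s) (fun x => x * g ε x) T
        h1.continuousOn (by fun_prop), cfc_mul (fun x : ℝ => x) (g ε) T (by fun_prop)
        h2.continuousOn, cfc_id' ℝ T]
    rw [e]
    refine norm_cfc_le (by positivity) fun x hx => ?_
    have hx0 : 0 ≤ x := spectrum_nonneg_of_nonneg hT hx
    rcases le_total ε x with h | h
    · have hxp : 0 < x := hε.trans_le h
      have : x ^ s - x * g ε x = 0 := by
        simp only [g, max_eq_left h]
        rw [Real.rpow_sub_one hxp.ne']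
        field_simp
        ring
      rw [this, norm_zero]
      positivity
    · simp only [g, max_eq_right h]
      have h1 : x ^ s ≤ ε ^ s := Real.rpow_le_rpow hx0 h hs.le
      have h2 : x * ε ^ (s - 1) ≤ ε ^ s := by
        calc x * ε ^ (s - 1) ≤ ε * ε ^ (s - 1) := by gcongr
          _ = ε ^ s := by rw [Real.rpow_sub_one hε.ne']; field_simp
      have h3 : 0 ≤ x ^ s := by positivity
      have h4 : 0 ≤ x * ε ^ (s - 1) := by positivity
      rw [Real.norm_eq_abs, abs_le]
      constructor <;> linarith
  have hlim : Tendsto (fun ε : ℝ => T * cfc (g ε) T) (𝓝[>] 0) (𝓝 (T ^ s)) := by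
    rw [tendsto_iff_norm_sub_tendsto_zero]
    have h0 : Tendsto (fun ε : ℝ => ε ^ s) (𝓝[>] 0) (𝓝 0) := by
      have := (Real.continuous_rpow_const hs.le).tendsto 0
      rw [Real.zero_rpow hs.ne'] at this
      exact this.mono_left nhdsWithin_le_nhds
    refine squeeze_zero' (Eventually.of_forall fun _ => norm_nonneg _) ?_ h0
    filter_upwards [self_mem_nhdsWithin] with ε hε
    rw [norm_sub_rev]
    exact hbound ε hε
  exact isCompactOperator_of_tendsto hlim
    (Eventually.of_forall fun ε => hc.comp_clm (cfc (g ε) T))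

/-- A positive operator of finite trace is compact. -/
theorem isCompactOperator_of_trace_ne_top {T : H →L[ℂ] H} (hT : 0 ≤ T) (htr : trace T ≠ ⊤) :
    IsCompactOperator T := by
  obtain ⟨S, hS, rfl⟩ : ∃ S : H →L[ℂ] H, IsSelfAdjoint S ∧ T = S * S :=
    ⟨CFC.sqrt T, (CFC.sqrt_nonneg T).isSelfAdjoint, (CFC.sqrt_mul_sqrt_self T).symm⟩
  have sym : ∀ x y : H, ⟪x, S y⟫_ℂ = ⟪S x, y⟫_ℂ := fun x y =>
    ((ContinuousLinearMap.isSelfAdjoint_iff_isSymmetric.mp hS) x y).symm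
  have key : ∀ x : H, RCLike.re ⟪x, (S * S) x⟫_ℂ = ‖S x‖ ^ 2 := by
    intro x
    rw [mul_apply_eq_comp, sym]
    exact inner_self_eq_norm_sq (𝕜 := ℂ) (S x)
  obtain ⟨w, b, -⟩ := exists_hilbertBasis ℂ H
  rw [trace_eq b hT] at htr
  simp only [key] at htr
  suffices hSc : IsCompactOperator S from hSc.comp_clm S
  -- Finite-rank projections; `R F * S → S` in norm because `S` is Hilbert–Schmidt: the error is
  -- controlled by the tail `ε F` of `∑ ‖S b_i‖ ^ 2 = Tr T`.
  let R : Finset w → H →L[ℂ] H := fun F => ∑ i ∈ F, (innerSL ℂ (b i)).smulRight (b i)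
  have hRc : ∀ F, IsCompactOperator (R F) := by
    intro F
    have hmem : R F ∈ compactOperator (RingHom.id ℂ) H H := by
      refine Submodule.sum_mem _ fun i _ => ?_
      have h1 : IsCompactOperator (innerSL ℂ (b i)) :=
        isCompactOperator_of_locallyCompactSpace_dom (innerSL ℂ (b i))
      exact h1.clm_comp (ContinuousLinearMap.toSpanSingleton ℂ (b i))
    exact hmem
  classical
  have hR : ∀ F v j, ⟪b j, v - R F v⟫_ℂ = if j ∈ F then 0 else ⟪b j, v⟫_ℂ := by
    intro F v j
    have : ∀ i, ⟪b j, b i⟫_ℂ = if j = i then 1 else 0 := orthonormal_iff_ite.mp b.orthonormal j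
    simp only [R, inner_sub_right, sum_apply, inner_sum,
      ContinuousLinearMap.smulRight_apply, innerSL_apply_apply, inner_smul_right, this]
    simp
    split_ifs <;> simp
  let ε : Finset w → ℝ≥0∞ := fun F => ∑' i : {x // x ∉ F}, ENNReal.ofReal (‖S (b i)‖ ^ 2)
  have hε : Tendsto ε atTop (𝓝 0) := ENNReal.tendsto_tsum_compl_atTop_zero htr
  have hεt : ∀ F, ε F ≠ ⊤ := fun F =>
    ne_top_of_le_ne_top htr (ENNReal.tsum_comp_le_tsum_of_injective Subtype.val_injective _)
  have hb : ∀ F v, ‖(S - R F * S) v‖ ^ 2 ≤ (ε F).toReal * ‖v‖ ^ 2 := by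
    intro F v
    have : ENNReal.ofReal (‖(S - R F * S) v‖ ^ 2) ≤ ε F * ENNReal.ofReal (‖v‖ ^ 2) := by
      rw [← tsum_enorm_inner_sq b]
      have hin : ∀ j, ⟪b j, (S - R F * S) v⟫_ℂ = if j ∈ F then 0 else ⟪b j, S v⟫_ℂ :=
        fun j => hR F (S v) j
      calc ∑' j, ENNReal.ofReal (‖⟪b j, (S - R F * S) v⟫_ℂ‖ ^ 2)
          ≤ ∑' j, Set.indicator {x | x ∉ F} (fun j => ENNReal.ofReal (‖S (b j)‖ ^ 2)) j
              * ENNReal.ofReal (‖v‖ ^ 2) := by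
            refine ENNReal.tsum_le_tsum fun j => ?_
            rw [hin]
            by_cases h : j ∈ F
            · simp [h]
            · rw [if_neg h, Set.indicator_of_mem (by exact h),
                ← ENNReal.ofReal_mul (by positivity), ← mul_pow, sym]
              gcongr
              exact norm_inner_le_norm _ _
        _ = ε F * ENNReal.ofReal (‖v‖ ^ 2) := by
            rw [ENNReal.tsum_mul_right]
            congr 1
            exact (tsum_subtype {x | x ∉ F} (fun j => ENNReal.ofReal (‖S (b j)‖ ^ 2))).symm
    have h2 := ENNReal.toReal_mono (by finiteness [hεt F]) this
    rwa [ENNReal.toReal_mul, ENNReal.toReal_ofReal (by positivity),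
      ENNReal.toReal_ofReal (by positivity)] at h2
  have hnorm : ∀ F, ‖S - R F * S‖ ≤ Real.sqrt (ε F).toReal := fun F =>
    ContinuousLinearMap.opNorm_le_bound _ (Real.sqrt_nonneg _) fun v => by
      refine abs_le_of_sq_le_sq' ?_ (by positivity) |>.2
      rw [mul_pow, Real.sq_sqrt ENNReal.toReal_nonneg]
      exact hb F v
  have hlim : Tendsto (fun F => R F * S) atTop (𝓝 S) := by
    rw [tendsto_iff_norm_sub_tendsto_zero]
    have h0 : Tendsto (fun F => Real.sqrt (ε F).toReal) atTop (𝓝 0) := by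
      have := (Real.continuous_sqrt.tendsto _).comp
        ((ENNReal.tendsto_toReal ENNReal.zero_ne_top).comp hε)
      simpa [Function.comp_def] using this
    refine squeeze_zero (fun _ => norm_nonneg _) (fun F => ?_) h0
    rw [norm_sub_rev]
    exact hnorm F
  exact isCompactOperator_of_tendsto hlim (Eventually.of_forall fun F => (hRc F).comp_clm S)

/-- A compact positive operator has a Hilbert basis of eigenvectors. -/
theorem exists_eigenbasis.{u} {H : Type u} [NormedAddCommGroup H] [InnerProductSpace ℂ H]
    [CompleteSpace H] {T : H →L[ℂ] H} (hT : 0 ≤ T) (hc : IsCompactOperator T) :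
    ∃ (ι : Type u) (b : HilbertBasis ι ℂ H) (a : ι → ℝ),
      (∀ i, 0 ≤ a i) ∧ ∀ i, T (b i) = (a i : ℂ) • b i := by
  have hpos := (ContinuousLinearMap.nonneg_iff_isPositive T).mp hT
  have hsym : (T : H →ₗ[ℂ] H).IsSymmetric := hpos.isSymmetric
  have hbot := ContinuousLinearMap.orthogonalComplement_iSup_eigenspaces_eq_bot hc hsym
  let V : ℂ → Submodule ℂ H := fun μ => Module.End.eigenspace (T : H →ₗ[ℂ] H) μ
  have : ∀ μ, CompleteSpace (V μ) := fun μ => by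
    have hcl : IsClosed (V μ : Set H) := by
      have : (V μ : Set H) = {x | T x = μ • x} := by
        ext x
        exact Module.End.mem_eigenspace_iff
      rw [this]
      exact isClosed_eq T.continuous (continuous_const_smul μ)
    exact hcl.completeSpace_coe
  choose w c hcw using fun μ => exists_hilbertBasis ℂ (V μ)
  let v : (Σ μ, w μ) → H := fun p => (c p.1 p.2 : H)
  have hv : Orthonormal ℂ v :=
    hsym.orthogonalFamily_eigenspaces.orthonormal_sigma_orthonormal fun μ => (c μ).orthonormal
  -- A vector orthogonal to the bases of all eigenspaces is orthogonal to every eigenspace, hence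
  -- zero by the spectral theorem `hbot`.
  have hsp : (Submodule.span ℂ (Set.range v))ᗮ = ⊥ := by
    rw [eq_bot_iff, ← hbot]
    intro x hx
    rw [← Submodule.iInf_orthogonal, Submodule.mem_iInf]
    intro μ y hy
    have hx' : ∀ i, ⟪((c μ i : V μ) : H), x⟫_ℂ = 0 := fun i =>
      hx _ (Submodule.subset_span ⟨⟨μ, i⟩, rfl⟩)
    have hs := ((c μ).hasSum_repr ⟨y, hy⟩).mapL ((innerSL ℂ x).comp (V μ).subtypeL)
    rw [inner_eq_zero_symm]
    refine hs.unique (hasSum_zero.congr_fun fun i => ?_)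
    simp [inner_eq_zero_symm.mp (hx' i)]
  let b : HilbertBasis (Σ μ, w μ) ℂ H := HilbertBasis.mkOfOrthogonalEqBot hv hsp
  have hb : ∀ i, b i = v i := fun i => by simp [b]
  have heig : ∀ i, T (b i) = i.1 • b i := fun i => by
    rw [hb]
    exact Module.End.mem_eigenspace_iff.mp (c i.1 i.2).2
  have hreal : ∀ i : Σ μ, w μ, ∃ r : ℝ, 0 ≤ r ∧ (r : ℂ) = i.1 := fun i => by
    have h := hpos.inner_nonneg_right (b i)
    rw [heig, inner_smul_right, inner_self_eq_norm_sq_to_K, b.orthonormal.1 i] at h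
    norm_num at h
    rw [Complex.nonneg_iff] at h
    exact ⟨i.1.re, h.1, Complex.ext rfl h.2⟩
  choose a ha using hreal
  exact ⟨_, b, a, fun i => (ha i).1, fun i => by rw [(ha i).2, heig]⟩

/-! ### Diagonal elements of operator powers. -/

/-- The diagonal matrix element `⟨v, T v⟩` of a positive operator `T`. -/
noncomputable def diag (T : H →L[ℂ] H) (v : H) : ℝ≥0∞ := ENNReal.ofReal (RCLike.re ⟪v, T v⟫_ℂ)

theorem trace_eq_tsum_diag {ι : Type*} (b : HilbertBasis ι ℂ H) {T : H →L[ℂ] H} (hT : 0 ≤ T) :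
    trace T = ∑' i, diag T (b i) :=
  trace_eq b hT

section Eigenbasis

variable {ι : Type*} {b : HilbertBasis ι ℂ H} {T : H →L[ℂ] H} {a : ι → ℝ}

theorem diag_rpow_basis (hT : 0 ≤ T) (ha : ∀ i, 0 ≤ a i)
    (hb : ∀ i, T (b i) = (a i : ℂ) • b i) {s : ℝ} (hs : 0 ≤ s) (i : ι) :
    diag (T ^ s) (b i) = ENNReal.ofReal (a i) ^ s := by
  rw [diag, rpow_apply_of_apply_eq_smul hT hs (hb i), inner_smul_right,
    inner_self_eq_norm_sq_to_K, b.orthonormal.1 i, ENNReal.ofReal_rpow_of_nonneg (ha i) hs]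
  simp

theorem trace_rpow_eq_tsum (hT : 0 ≤ T) (ha : ∀ i, 0 ≤ a i)
    (hb : ∀ i, T (b i) = (a i : ℂ) • b i) {s : ℝ} (hs : 0 ≤ s) :
    trace (T ^ s) = ∑' i, ENNReal.ofReal (a i) ^ s := by
  rw [trace_eq_tsum_diag b CFC.rpow_nonneg]
  exact tsum_congr (diag_rpow_basis hT ha hb hs)

/-- Turns operator inequalities into scalar ones for the spectral weights of `v`. With `0 ^ 0 = 1`
the case `s = 0` is Parseval's identity. -/
theorem diag_rpow_eq_tsum (hT : 0 ≤ T) (ha : ∀ i, 0 ≤ a i)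
    (hb : ∀ i, T (b i) = (a i : ℂ) • b i) {s : ℝ} (hs : 0 ≤ s) (v : H) :
    diag (T ^ s) v =
      ∑' i, ENNReal.ofReal (a i) ^ s * ENNReal.ofReal (‖⟪b i, v⟫_ℂ‖ ^ 2) := by
  have hsym := ContinuousLinearMap.isSelfAdjoint_iff_isSymmetric.mp
    (CFC.rpow_nonneg (a := T) (y := s)).isSelfAdjoint
  have h := Complex.hasSum_re (b.hasSum_inner_mul_inner v ((T ^ s) v))
  have e : ∀ i, (⟪v, b i⟫_ℂ * ⟪b i, (T ^ s) v⟫_ℂ).re = a i ^ s * ‖⟪b i, v⟫_ℂ‖ ^ 2 := by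
    intro i
    have h1 : ⟪b i, (T ^ s) v⟫_ℂ = ((a i ^ s : ℝ) : ℂ) * ⟪b i, v⟫_ℂ := by
      rw [← ContinuousLinearMap.coe_coe, ← hsym, ContinuousLinearMap.coe_coe,
        rpow_apply_of_apply_eq_smul hT hs (hb i), inner_smul_left, Complex.conj_ofReal]
    rw [h1, ← inner_conj_symm v (b i), mul_left_comm, ← Complex.normSq_eq_conj_mul_self,
      ← Complex.ofReal_mul, Complex.ofReal_re, Complex.normSq_eq_norm_sq]
  simp only [e] at h
  have hnn : ∀ i, 0 ≤ a i ^ s * ‖⟪b i, v⟫_ℂ‖ ^ 2 := fun i =>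
    mul_nonneg (Real.rpow_nonneg (ha i) s) (by positivity)
  rw [diag]
  change ENNReal.ofReal (Complex.re _) = _
  rw [← h.tsum_eq, ENNReal.ofReal_tsum_of_nonneg hnn h.summable]
  refine tsum_congr fun i => ?_
  rw [ENNReal.ofReal_mul (Real.rpow_nonneg (ha i) s), ENNReal.ofReal_rpow_of_nonneg (ha i) hs]

end Eigenbasis

variable {T : H →L[ℂ] H}

/-- The diagonal elements of the powers of a compact positive operator are log-convex in the
exponent. -/
theorem diag_rpow_convexComb_le (hT : 0 ≤ T) (hc : IsCompactOperator T) {p q s₀ s₁ : ℝ}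
    (hp : 0 ≤ p) (hq : 0 ≤ q) (hpq : p + q = 1) (h₀ : 0 ≤ s₀) (h₁ : 0 ≤ s₁) (v : H) :
    diag (T ^ (p * s₀ + q * s₁)) v ≤ diag (T ^ s₀) v ^ p * diag (T ^ s₁) v ^ q := by
  obtain ⟨ι, b, a, ha, hb⟩ := exists_eigenbasis hT hc
  rw [diag_rpow_eq_tsum hT ha hb h₀, diag_rpow_eq_tsum hT ha hb h₁,
    diag_rpow_eq_tsum hT ha hb (by positivity)]
  refine le_trans (le_of_eq (tsum_congr fun i => ?_)) (tsum_rpow_mul_rpow_le _ _ hp hq hpq)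
  rw [ENNReal.mul_rpow_of_nonneg _ _ hp, ENNReal.mul_rpow_of_nonneg _ _ hq, mul_mul_mul_comm,
    ← ENNReal.rpow_add_of_nonneg _ _ hp hq, hpq, ENNReal.rpow_one, ← ENNReal.rpow_mul,
    ← ENNReal.rpow_mul, ← ENNReal.rpow_add_of_nonneg _ _ (by positivity) (by positivity),
    mul_comm s₀, mul_comm s₁]

theorem diag_one_of_norm_eq_one {v : H} (hv : ‖v‖ = 1) : diag (1 : H →L[ℂ] H) v = 1 := by
  rw [diag, one_apply_eq_self, inner_self_eq_norm_sq (𝕜 := ℂ), hv]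
  simp

/-- Jensen's inequality for the powers of a compact positive operator in a unit vector state. -/
theorem diag_rpow_le_diag_rpow (hT : 0 ≤ T) (hc : IsCompactOperator T) {r : ℝ} (hr : 1 ≤ r)
    {v : H} (hv : ‖v‖ = 1) : diag T v ^ r ≤ diag (T ^ r) v := by
  have hr0 : 0 < r := by linarith
  -- Log-convexity at `1 = r⁻¹ * r + (1 - r⁻¹) * 0`; the exponent `0` contributes `‖v‖ ^ 2 = 1`.
  have h := diag_rpow_convexComb_le hT hc (p := r⁻¹) (q := 1 - r⁻¹) (s₀ := r) (s₁ := 0)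
    (by positivity) (sub_nonneg.mpr (inv_le_one_of_one_le₀ hr)) (by ring) hr0.le le_rfl v
  rw [mul_zero, add_zero, inv_mul_cancel₀ hr0.ne', CFC.rpow_one T, CFC.rpow_zero T,
    diag_one_of_norm_eq_one hv, ENNReal.one_rpow, mul_one] at h
  calc diag T v ^ r ≤ (diag (T ^ r) v ^ r⁻¹) ^ r := by gcongr
    _ = diag (T ^ r) v := ENNReal.rpow_inv_rpow hr0.ne' _

/-! ### Channels: finiteness and positivity of the trace. -/

variable {X : Type*} (W : Channel X H)

theorem Channel.nonneg (x : X) : 0 ≤ (W x : H →L[ℂ] H) := (W x).2.1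

theorem Channel.trace_eq_one (x : X) : trace (W x : H →L[ℂ] H) = 1 := (W x).2.2

theorem Channel.isCompactOperator (x : X) : IsCompactOperator (W x : H →L[ℂ] H) :=
  isCompactOperator_of_trace_ne_top (W.nonneg x) (by rw [W.trace_eq_one x]; simp)

variable [Fintype X] (P : stdSimplex ℝ X)

theorem meanPow_nonneg (s : ℝ) : 0 ≤ meanPow W P s :=
  Finset.sum_nonneg fun x _ => smul_nonneg (P.2.1 x) CFC.rpow_nonneg

theorem isCompactOperator_meanPow {s : ℝ} (hs : 0 < s) : IsCompactOperator (meanPow W P s) := by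
  have hmem : meanPow W P s ∈ compactOperator (RingHom.id ℂ) H H :=
    Submodule.sum_mem _ fun x _ =>
      (isCompactOperator_rpow (W.nonneg x) (W.isCompactOperator x) hs).smul (P.1 x)
  exact hmem

theorem diag_meanPow (s : ℝ) (v : H) :
    diag (meanPow W P s) v =
      ∑ x, ENNReal.ofReal (P.1 x) * diag ((W x : H →L[ℂ] H) ^ s) v := by
  have hnn : ∀ x, 0 ≤ RCLike.re ⟪v, ((W x : H →L[ℂ] H) ^ s) v⟫_ℂ := fun x =>
    ((ContinuousLinearMap.nonneg_iff_isPositive _).mp CFC.rpow_nonneg).re_inner_nonneg_right v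
  have e : RCLike.re ⟪v, meanPow W P s v⟫_ℂ =
      ∑ x, P.1 x * RCLike.re ⟪v, ((W x : H →L[ℂ] H) ^ s) v⟫_ℂ := by
    rw [meanPow, sum_apply, inner_sum, map_sum]
    refine Finset.sum_congr rfl fun x _ => ?_
    rw [smul_apply, RCLike.real_smul_eq_coe_smul (K := ℂ), inner_smul_right,
      RCLike.re_ofReal_mul]
    rfl
  rw [diag, e, ENNReal.ofReal_sum_of_nonneg fun x _ => mul_nonneg (P.2.1 x) (hnn x)]
  exact Finset.sum_congr rfl fun x _ => ENNReal.ofReal_mul (P.2.1 x)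

theorem sum_ofReal_eq_one : ∑ x, ENNReal.ofReal (P.1 x) = 1 := by
  rw [← ENNReal.ofReal_sum_of_nonneg fun x _ => P.2.1 x, P.2.2, ENNReal.ofReal_one]

/-- Jensen twice in the eigenbasis of the mean, for `P` and then for the state `b i`, gives `a_i ^ t
≤ ∑ x, P x ⟨b_i, W_x b_i⟩`; summing over `i` gives total trace `1`. -/
theorem tracePow_le_one {t : ℝ} (ht : 1 ≤ t) : tracePow W P t ≤ 1 := by
  have ht0 : 0 < t := by linarith
  obtain ⟨ι, b, a, ha, hb⟩ := exists_eigenbasis (meanPow_nonneg W P (1 / t))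
    (isCompactOperator_meanPow W P (by positivity))
  have hterm : ∀ i, ENNReal.ofReal (a i) ^ t ≤
      ∑ x, ENNReal.ofReal (P.1 x) * diag (W x : H →L[ℂ] H) (b i) := by
    intro i
    have h1 := diag_rpow_basis (meanPow_nonneg W P (1 / t)) ha hb zero_le_one i
    rw [CFC.rpow_one _ (meanPow_nonneg W P (1 / t)), ENNReal.rpow_one, diag_meanPow] at h1
    rw [← h1]
    refine (ENNReal.rpow_arith_mean_le_arith_mean_rpow _ _ _ (sum_ofReal_eq_one P) ht).trans ?_
    gcongr with x
    refine (diag_rpow_le_diag_rpow CFC.rpow_nonneg (isCompactOperator_rpow (W.nonneg x)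
      (W.isCompactOperator x) (by positivity)) ht (b.orthonormal.1 i)).trans_eq ?_
    rw [CFC.rpow_rpow_of_exponent_nonneg _ _ _ (by positivity) (by positivity) (W.nonneg x),
      one_div_mul_cancel ht0.ne', CFC.rpow_one _ (W.nonneg x)]
  rw [tracePow, trace_rpow_eq_tsum (meanPow_nonneg W P _) ha hb ht0.le]
  refine (ENNReal.tsum_le_tsum hterm).trans_eq ?_
  rw [Summable.tsum_finsetSum fun _ _ => ENNReal.summable]
  simp_rw [ENNReal.tsum_mul_left, ← trace_eq_tsum_diag b (W.nonneg _), W.trace_eq_one, mul_one]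
  exact sum_ofReal_eq_one P

/-- A zero trace kills every diagonal element of the mean, hence, for some `x` with `P x > 0`, every
eigenvalue of `W_x`, against `Tr W_x = 1`. -/
theorem tracePow_pos {t : ℝ} (ht : 1 ≤ t) : 0 < tracePow W P t := by
  have ht0 : 0 < t := by linarith
  have hA := meanPow_nonneg W P (1 / t)
  obtain ⟨ι, b, a, ha, hb⟩ := exists_eigenbasis hA
    (isCompactOperator_meanPow W P (by positivity))
  rw [pos_iff_ne_zero]
  intro h0
  rw [tracePow, trace_rpow_eq_tsum hA ha hb ht0.le, ENNReal.tsum_eq_zero] at h0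
  have hdiag : ∀ v, diag (meanPow W P (1 / t)) v = 0 := by
    intro v
    rw [← CFC.rpow_one _ hA, diag_rpow_eq_tsum hA ha hb zero_le_one, ENNReal.tsum_eq_zero]
    intro i
    rw [ENNReal.rpow_one, (ENNReal.rpow_eq_zero_iff_of_pos ht0).mp (h0 i), zero_mul]
  obtain ⟨x, hx⟩ : ∃ x, ENNReal.ofReal (P.1 x) ≠ 0 := by
    by_contra! h
    simpa [h] using sum_ofReal_eq_one P
  obtain ⟨κ, c, w, hw, hc⟩ := exists_eigenbasis (W.nonneg x) (W.isCompactOperator x)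
  have hw0 : ∀ j, ENNReal.ofReal (w j) = 0 := by
    intro j
    have h1 := hdiag (c j)
    rw [diag_meanPow, Finset.sum_eq_zero_iff] at h1
    have h2 := (mul_eq_zero.mp (h1 x (Finset.mem_univ x))).resolve_left hx
    rwa [diag_rpow_basis (W.nonneg x) hw hc (by positivity),
      ENNReal.rpow_eq_zero_iff_of_pos (by positivity)] at h2
  have h1 := trace_rpow_eq_tsum (W.nonneg x) hw hc zero_le_one
  rw [CFC.rpow_one _ (W.nonneg x), W.trace_eq_one] at h1
  simp [hw0] at h1

/-! ### Interpolation inequality. -/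

/-- Hölder with exponents `1 - 1/r` and `1/r`, then Jensen `⟨b_i, A_r b_i⟩ ^ r ≤ ⟨b_i, A_r ^ r
b_i⟩`. The basis need not diagonalize `A_r`, so it may be the eigenbasis of another mean. -/
theorem tsum_rpow_mul_diag_meanPow_le {ι : Type*} (b : HilbertBasis ι ℂ H) (a : ι → ℝ≥0∞)
    {t r : ℝ} (hr : 1 ≤ r) :
    ∑' i, a i ^ (t * (1 - 1 / r)) * diag (meanPow W P (1 / r)) (b i) ≤
      (∑' i, a i ^ t) ^ (1 - 1 / r) * tracePow W P r ^ (1 / r) := by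
  have hr0 : 0 < r := by linarith
  have hr1 : 0 ≤ 1 - 1 / r := by
    rw [sub_nonneg, div_le_one hr0]
    exact hr
  rw [tracePow, trace_eq_tsum_diag b CFC.rpow_nonneg]
  refine le_trans (ENNReal.tsum_le_tsum fun i => ?_)
    (tsum_rpow_mul_rpow_le _ _ hr1 (by positivity) (by ring))
  rw [ENNReal.rpow_mul]
  gcongr
  have h := diag_rpow_le_diag_rpow (meanPow_nonneg W P (1 / r))
    (isCompactOperator_meanPow W P (by positivity)) hr (b.orthonormal.1 i)
  rwa [one_div r, ENNReal.le_rpow_inv_iff hr0, ← one_div]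

/-- The interpolation inequality behind the log-convexity of `tracePow`, in implicit form: the
traces at `t` on the right have total exponent `1 - 1 / t`. -/
theorem tracePow_le_rpow_mul_rpow {p q t t₀ t₁ : ℝ} (hp : 0 ≤ p) (hq : 0 ≤ q) (hpq : p + q = 1)
    (ht : 1 ≤ t) (h₀ : 1 ≤ t₀) (h₁ : 1 ≤ t₁) (h : 1 / t = p * (1 / t₀) + q * (1 / t₁)) :
    tracePow W P t ≤
      (tracePow W P t ^ (1 - 1 / t₀) * tracePow W P t₀ ^ (1 / t₀)) ^ p *
        (tracePow W P t ^ (1 - 1 / t₁) * tracePow W P t₁ ^ (1 / t₁)) ^ q := by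
  have ht0 : 0 < t := by linarith
  have h₀0 : 0 < t₀ := by linarith
  have h₁0 : 0 < t₁ := by linarith
  have hu₀ : 0 ≤ t * (1 - 1 / t₀) := mul_nonneg ht0.le (by rwa [sub_nonneg, div_le_one h₀0])
  have hu₁ : 0 ≤ t * (1 - 1 / t₁) := mul_nonneg ht0.le (by rwa [sub_nonneg, div_le_one h₁0])
  have hA := meanPow_nonneg W P (1 / t)
  obtain ⟨ι, b, a, ha, hb⟩ := exists_eigenbasis hA
    (isCompactOperator_meanPow W P (by positivity))
  have hF : tracePow W P t = ∑' i, ENNReal.ofReal (a i) ^ t :=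
    trace_rpow_eq_tsum hA ha hb ht0.le
  have hexp : t - 1 = t * (1 - 1 / t₀) * p + t * (1 - 1 / t₁) * q := by
    have h2 : t * (1 / t) = 1 := mul_one_div_cancel ht0.ne'
    rw [h] at h2
    linear_combination h2 - t * hpq
  -- The exponent of `a` is affine in `u` and equals `t - 1` at `u = 1/t`, so `f` is log-convex in
  -- `u` and sums to `F(t)` at `1/t`.
  let f : ℝ → ι × X → ℝ≥0∞ := fun u y =>
    ENNReal.ofReal (a y.1) ^ (t * (1 - u)) *
      (ENNReal.ofReal (P.1 y.2) * diag ((W y.2 : H →L[ℂ] H) ^ u) (b y.1))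
  have hf : ∀ u, ∑' y, f u y =
      ∑' i, ENNReal.ofReal (a i) ^ (t * (1 - u)) * diag (meanPow W P u) (b i) := by
    intro u
    rw [ENNReal.tsum_prod']
    refine tsum_congr fun i => ?_
    rw [tsum_fintype, diag_meanPow, Finset.mul_sum]
  have hFf : tracePow W P t = ∑' y, f (1 / t) y := by
    rw [hf, hF]
    refine tsum_congr fun i => ?_
    have h1 := diag_rpow_basis hA ha hb zero_le_one i
    rw [CFC.rpow_one _ hA] at h1
    rw [h1, ← ENNReal.rpow_add_of_nonneg _ _ _ zero_le_one]
    · congr 1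
      field_simp
      ring
    · exact mul_nonneg ht0.le (by rwa [sub_nonneg, div_le_one ht0])
  have hle : ∀ y, f (1 / t) y ≤ f (1 / t₀) y ^ p * f (1 / t₁) y ^ q := by
    rintro ⟨i, x⟩
    have hd := diag_rpow_convexComb_le (W.nonneg x) (W.isCompactOperator x) hp hq hpq
      (s₀ := 1 / t₀) (s₁ := 1 / t₁) (by positivity) (by positivity) (b i)
    rw [← h] at hd
    have hP : ENNReal.ofReal (P.1 x) =
        ENNReal.ofReal (P.1 x) ^ p * ENNReal.ofReal (P.1 x) ^ q := by
      rw [← ENNReal.rpow_add_of_nonneg _ _ hp hq, hpq, ENNReal.rpow_one]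
    have ha' : ENNReal.ofReal (a i) ^ (t * (1 - 1 / t)) =
        (ENNReal.ofReal (a i) ^ (t * (1 - 1 / t₀))) ^ p *
          (ENNReal.ofReal (a i) ^ (t * (1 - 1 / t₁))) ^ q := by
      rw [← ENNReal.rpow_mul, ← ENNReal.rpow_mul, ← ENNReal.rpow_add_of_nonneg _ _
        (by positivity) (by positivity), ← hexp]
      congr 1
      field_simp
    simp only [f]
    simp only [ENNReal.mul_rpow_of_nonneg _ _ hp, ENNReal.mul_rpow_of_nonneg _ _ hq]
    calc _ ≤ ENNReal.ofReal (a i) ^ (t * (1 - 1 / t)) * (ENNReal.ofReal (P.1 x) *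
          (diag ((W x : H →L[ℂ] H) ^ (1 / t₀)) (b i) ^ p *
            diag ((W x : H →L[ℂ] H) ^ (1 / t₁)) (b i) ^ q)) := by gcongr
      _ = _ := by
        rw [ha']
        nth_rw 1 [hP]
        ring
  calc tracePow W P t = ∑' y, f (1 / t) y := hFf
    _ ≤ ∑' y, f (1 / t₀) y ^ p * f (1 / t₁) y ^ q := ENNReal.tsum_le_tsum hle
    _ ≤ (∑' y, f (1 / t₀) y) ^ p * (∑' y, f (1 / t₁) y) ^ q :=
      tsum_rpow_mul_rpow_le _ _ hp hq hpq
    _ ≤ _ := by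
      rw [hf, hf, hF]
      gcongr
      · exact tsum_rpow_mul_diag_meanPow_le W P b _ h₀
      · exact tsum_rpow_mul_diag_meanPow_le W P b _ h₁

/-! ### Convexity of the logarithm. -/

theorem toReal_tracePow_pos {t : ℝ} (ht : 1 ≤ t) : 0 < (tracePow W P t).toReal :=
  ENNReal.toReal_pos (tracePow_pos W P ht).ne'
    (ne_top_of_le_ne_top ENNReal.one_ne_top (tracePow_le_one W P ht))

theorem convexOn_log_tracePow :
    ConvexOn ℝ (Set.Ici 1) fun t : ℝ => Real.log (tracePow W P t).toReal := by
  refine ⟨convex_Ici 1, ?_⟩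
  intro t₀ h₀ t₁ h₁ α β hα hβ hαβ
  have ht : α • t₀ + β • t₁ ∈ Set.Ici (1 : ℝ) := convex_Ici 1 h₀ h₁ hα hβ hαβ
  simp only [smul_eq_mul, Set.mem_Ici] at *
  set t := α * t₀ + β * t₁ with ht_def
  have ht0 : 0 < t := by linarith
  have h₀0 : 0 < t₀ := by linarith
  have h₁0 : 0 < t₁ := by linarith
  -- These weights make `1/t` the corresponding average of `1/t₀` and `1/t₁`, as `α + β = 1`.
  have hpq : α * t₀ / t + β * t₁ / t = 1 := by
    rw [← add_div, ← ht_def, div_self ht0.ne']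
  have hinv : 1 / t = α * t₀ / t * (1 / t₀) + β * t₁ / t * (1 / t₁) := by
    field_simp
    exact hαβ.symm
  have h := tracePow_le_rpow_mul_rpow W P (by positivity) (by positivity) hpq ht h₀ h₁ hinv
  have hF := toReal_tracePow_pos W P ht
  have hF₀ := toReal_tracePow_pos W P h₀
  have hF₁ := toReal_tracePow_pos W P h₁
  have hFt := (tracePow_le_one W P ht).trans_lt ENNReal.one_lt_top
  have hFt₀ := (tracePow_le_one W P h₀).trans_lt ENNReal.one_lt_top
  have hFt₁ := (tracePow_le_one W P h₁).trans_lt ENNReal.one_lt_top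
  rw [← ENNReal.ofReal_toReal hFt.ne, ← ENNReal.ofReal_toReal hFt₀.ne,
    ← ENNReal.ofReal_toReal hFt₁.ne] at h
  set F := (tracePow W P t).toReal
  set F₀ := (tracePow W P t₀).toReal
  set F₁ := (tracePow W P t₁).toReal
  rw [ENNReal.ofReal_rpow_of_pos hF, ENNReal.ofReal_rpow_of_pos hF, ENNReal.ofReal_rpow_of_pos hF₀,
    ENNReal.ofReal_rpow_of_pos hF₁, ← ENNReal.ofReal_mul (by positivity),
    ← ENNReal.ofReal_mul (by positivity), ENNReal.ofReal_rpow_of_pos (by positivity),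
    ENNReal.ofReal_rpow_of_pos (by positivity), ← ENNReal.ofReal_mul (by positivity)] at h
  rw [ENNReal.ofReal_le_ofReal_iff (by positivity)] at h
  have hl := Real.log_le_log hF h
  rw [Real.log_mul (by positivity) (by positivity), Real.log_rpow (by positivity),
    Real.log_rpow (by positivity), Real.log_mul (by positivity) (by positivity),
    Real.log_mul (by positivity) (by positivity), Real.log_rpow hF, Real.log_rpow hF,
    Real.log_rpow hF₀, Real.log_rpow hF₁] at hl
  -- On the right of `hl`, `log F` has total coefficient `1 - 1/t`; moving it to the left leaves
  -- `1/t`.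
  have h2 : 1 / t * Real.log F ≤
      1 / t * (α * Real.log F₀ + β * Real.log F₁) := by
    have e : 1 / t * (α * Real.log F₀ + β * Real.log F₁) =
        α * t₀ / t * (1 / t₀ * Real.log F₀) + β * t₁ / t * (1 / t₁ * Real.log F₁) := by
      field_simp
    rw [e]
    have e2 : 1 / t * Real.log F =
        (α * t₀ / t * (1 / t₀) + β * t₁ / t * (1 / t₁)) * Real.log F := by rw [← hinv]
    rw [e2]
    have e3 : (α * t₀ / t + β * t₁ / t) * Real.log F = Real.log F := by rw [hpq, one_mul]
    linarith
  exact le_of_mul_le_mul_left h2 (by positivity)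

end CQ

theorem theorem1 {X : Type*} [Fintype X]
    {H : Type*} [NormedAddCommGroup H] [InnerProductSpace ℂ H] [CompleteSpace H]
    [TopologicalSpace.SeparableSpace H]
    (W : CQ.Channel X H) (P : stdSimplex ℝ X) :
    (∀ t : ℝ, 1 ≤ t → 0 < CQ.tracePow W P t ∧ CQ.tracePow W P t < ⊤) ∧
    ConcaveOn ℝ (Set.Ici 0) (fun s : ℝ => CQ.E₀ W s P) ∧
    ConvexOn ℝ (Set.Ici 1) (fun t : ℝ => Real.log (CQ.tracePow W P t).toReal) := by
  refine ⟨fun t ht => ⟨CQ.tracePow_pos W P ht,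
    (CQ.tracePow_le_one W P ht).trans_lt ENNReal.one_lt_top⟩, ?_, CQ.convexOn_log_tracePow W P⟩
  have h := (CQ.convexOn_log_tracePow W P).translate_right 1
  have hs : (fun z : ℝ => 1 + z) ⁻¹' Set.Ici 1 = Set.Ici 0 := by
    ext s
    simp
  rw [hs] at h
  exact h.neg
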